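/- Let $d\in\mathbb{N}$ and equip $\mathbb{R}^d$ with the Euclidean norm. Let $B(x,\delta)$ denote the open ball with centre $x$ and radius $\delta$, and for bounded $E\subset\mathbb{R}^d$ and $r>0$ let $N_r(E)$ denote the least number of open balls of radius $r$ required to cover $E$. For $\theta\in(0,1)$, the Assouad spectrum of a set $F\subset\mathbb{R}^d$ at $\theta$ is $$\dim_A^\theta F=\inf\Bigl\{\alpha\in\mathbb{R}:\ (\exists C>0)(\forall\, 0<\delta\le 1)(\forall x\in F)\quad N_{\delta^{1/\theta}}\bigl(F\cap B(x,\delta)\bigr)\le C\Bigl(\frac{\delta}{\delta^{1/\theta}}\Bigr)^{\alpha}\Bigr\},$$ with the infimum taken in $[-\infty,\infty]$ (so that $\dim_A^\theta\varnothing=-\infty$). Let $\varphi\colon(0,1)\to[0,d]$ be any function. Then there exists a set $F\subset\mathbb{R}^d$ such that $\dim_A^\theta F=\varphi(\theta)$ for all $\theta\in(0,1)$ if and only if for all $0<\lambda<\theta<1$, $$0\le(1-\lambda)\varphi(\lambda)-(1-\theta)\varphi(\theta)\le(\theta-\lambda)\,\varphi\Bigl(\frac{\lambda}{\theta}\Bigr).$$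 -/

import Mathlib

namespace AssouadSpectra

open scoped ENNReal

/-- `ballCoveringNumber r E` is the least number of open balls of radius `r`, centred at arbitrary
points of the ambient space, needed to cover `E` (it is `⊤` if there is no finite such cover). -/
noncomputable def ballCoveringNumber {X : Type*} [PseudoMetricSpace X] (r : ℝ) (E : Set X) : ℕ∞ :=
  ⨅ (S : Set X) (_ : E ⊆ ⋃ c ∈ S, Metric.ball c r), S.encard

/-- The real number `α` is an admissible exponent for the set `F` at the parameter `θ`: for some
`C > 0`, the set `F ∩ B(x, δ)` is covered by at most `C * (δ / δ ^ (1 / θ)) ^ α` balls of radius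
`δ ^ (1 / θ)`, for all `0 < δ ≤ 1` and all `x ∈ F`. -/
def IsAdmissibleExponent {X : Type*} [PseudoMetricSpace X] (θ : ℝ) (F : Set X) (α : ℝ) : Prop :=
  ∃ C : ℝ, 0 < C ∧ ∀ δ : ℝ, 0 < δ → δ ≤ 1 → ∀ x ∈ F,
    (ballCoveringNumber (δ ^ (1 / θ)) (F ∩ Metric.ball x δ) : ℝ≥0∞) ≤
      ENNReal.ofReal (C * (δ / δ ^ (1 / θ)) ^ α)

/-- The Assouad spectrum of `F` at `θ`: the infimum, in the extended reals, of all admissible real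
exponents. -/
noncomputable def assouadSpectrum {X : Type*} [PseudoMetricSpace X] (θ : ℝ) (F : Set X) : EReal :=
  ⨅ (α : ℝ) (_ : IsAdmissibleExponent θ F α), (α : EReal)

end AssouadSpectra

/-! Put `w θ = (1 - θ) φ θ`. With `r = δ ^ (1 / θ)`, `w θ` is the optimal growth exponent of the
covering numbers of `F ∩ B(x, r ^ θ)` at scale `r` (`HasGrowth`).

Necessity: `B(x, r ^ θ)` shrinks as `θ` grows, so `w` is antitone. For the upper bound, cover `B(x,
r ^ lam)` by balls of radius `r ^ θ`, then each of these at scale `r` (`HasGrowth.add`). Since `r ^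
lam = (r ^ θ) ^ (lam / θ)`, this gives `w lam ≤ θ w (lam / θ) + w θ`, which is the right-hand
inequality.

Sufficiency: for each `n` take a homogeneous set in the unit cube, built by restricting binary
digits, whose number of dyadic cubes from level `s` to level `t` is about `2 ^ (β t - β s)`, where
`β t = -n w (t / n)`. By hypothesis `β` is monotone and `β t - β (θ t) ≤ t w θ`, so no window grows
too fast; at `t = n` equality holds because `w` is extended by `0` to `1`. The bound `φ ≤ d` makes
`β` `d`-Lipschitz, so at most `d` binary digits per level suffice. A separated union over `n` has
exponent exactly `w θ` for every `θ` at once. -/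

namespace AssouadSpectra

open scoped ENNReal

/-! ### Finite covers and growth exponents -/

/-- `E` is covered by finitely many, at most `B`, open balls of radius `r`. -/
def FinCov {X : Type*} [PseudoMetricSpace X] (r : ℝ) (E : Set X) (B : ℝ) : Prop :=
  ∃ S : Finset X, (∀ y ∈ E, ∃ c ∈ S, dist y c < r) ∧ (S.card : ℝ) ≤ B

section FinCov

variable {X : Type*} [PseudoMetricSpace X]

theorem ballCoveringNumber_le_ofReal_iff {r B : ℝ} {E : Set X} (hB : 0 ≤ B) :
    (ballCoveringNumber r E : ℝ≥0∞) ≤ ENNReal.ofReal B ↔ FinCov r E B := by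
  constructor
  · intro h
    have hne : Nonempty {S : Set X // E ⊆ ⋃ c ∈ S, Metric.ball c r} ∨
        ballCoveringNumber r E = ⊤ := by
      by_cases hn : Nonempty {S : Set X // E ⊆ ⋃ c ∈ S, Metric.ball c r}
      · exact Or.inl hn
      · right
        unfold ballCoveringNumber
        simp only [iInf_eq_top]
        intro S hS
        exact (hn ⟨S, hS⟩).elim
    rcases hne with hne | htop
    · obtain ⟨⟨S, hS⟩, hmin⟩ := ENat.exists_eq_iInf
        (fun S : {S : Set X // E ⊆ ⋃ c ∈ S, Metric.ball c r} => S.1.encard)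
      have heq : ballCoveringNumber r E = S.encard := by
        unfold ballCoveringNumber
        exact iInf_subtype'.trans hmin.symm
      rw [heq] at h
      have hfin : S.Finite := by
        by_contra hinf
        rw [Set.Infinite.encard_eq hinf] at h
        simp at h
      refine ⟨hfin.toFinset, fun y hy => ?_, ?_⟩
      · obtain ⟨c, hc, hyc⟩ := Set.mem_iUnion₂.1 (hS hy)
        exact ⟨c, by simpa using hc, by simpa using hyc⟩
      · rw [hfin.encard_eq_coe_toFinset_card] at h
        rw [← ENNReal.ofReal_le_ofReal_iff hB]
        simpa using h
    · rw [htop] at h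
      simp at h
  · rintro ⟨S, hS, hc⟩
    have h1 : ballCoveringNumber r E ≤ (S.card : ℕ∞) := by
      unfold ballCoveringNumber
      refine (iInf₂_le (S : Set X) ?_).trans (by simp)
      intro y hy
      obtain ⟨c, hc, hyc⟩ := hS y hy
      exact Set.mem_iUnion₂.2 ⟨c, by simpa using hc, by simpa using hyc⟩
    have h2 : (ballCoveringNumber r E : ℝ≥0∞) ≤ (S.card : ℝ≥0∞) := by
      have := ENat.toENNReal_mono h1
      simpa using this
    refine h2.trans ?_
    rw [← ENNReal.ofReal_natCast]
    exact ENNReal.ofReal_le_ofReal hc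

theorem FinCov.mono {r r' B B' : ℝ} {E E' : Set X} (h : FinCov r E B) (hr : r ≤ r')
    (hE : E' ⊆ E) (hB : B ≤ B') : FinCov r' E' B' := by
  obtain ⟨S, hS, hc⟩ := h
  refine ⟨S, fun y hy => ?_, hc.trans hB⟩
  obtain ⟨c, hc, hyc⟩ := hS y (hE hy)
  exact ⟨c, hc, hyc.trans_le hr⟩

/-- If `E` is covered by at most `B` sets, each of which is covered by at most `B'` balls, then `E`
is covered by at most `B * B'` balls. -/
theorem FinCov.of_cover {ι : Type*} {r B B' : ℝ} {E : Set X} (S : Finset ι) (U : ι → Set X)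
    (hE : ∀ y ∈ E, ∃ i ∈ S, y ∈ U i) (hS : (S.card : ℝ) ≤ B) (hB' : 0 ≤ B')
    (hU : ∀ i ∈ S, FinCov r (E ∩ U i) B') : FinCov r E (B * B') := by
  classical
  choose! T hT hTc using hU
  refine ⟨S.biUnion T, fun y hy => ?_, ?_⟩
  · obtain ⟨i, hi, hyi⟩ := hE y hy
    obtain ⟨c, hc, hyc⟩ := hT i hi y ⟨hy, hyi⟩
    exact ⟨c, Finset.mem_biUnion.2 ⟨i, hi, hc⟩, hyc⟩
  · calc ((S.biUnion T).card : ℝ) ≤ ∑ i ∈ S, ((T i).card : ℝ) := by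
          exact_mod_cast Finset.card_biUnion_le
      _ ≤ ∑ _i ∈ S, B' := Finset.sum_le_sum hTc
      _ = S.card * B' := by simp
      _ ≤ B * B' := by gcongr

theorem FinCov.empty {r B : ℝ} (hB : 0 ≤ B) : FinCov r (∅ : Set X) B :=
  ⟨∅, by simp, by simpa using hB⟩

end FinCov

/-- The covering numbers of `F ∩ B(x, r ^ θ)` at scale `r` are `O(r ^ (-b))`, uniformly in `x`. -/
def HasGrowth {X : Type*} [PseudoMetricSpace X] (θ : ℝ) (F : Set X) (b : ℝ) : Prop :=
  ∃ C : ℝ, 0 < C ∧ ∀ r : ℝ, 0 < r → r ≤ 1 → ∀ x ∈ F,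
    FinCov r (F ∩ Metric.ball x (r ^ θ)) (C * r ^ (-b))

section Growth

variable {X : Type*} [PseudoMetricSpace X]

theorem isAdmissibleExponent_iff_hasGrowth {θ α : ℝ} {F : Set X} (h0 : 0 < θ) :
    IsAdmissibleExponent θ F α ↔ HasGrowth θ F ((1 - θ) * α) := by
  have key : ∀ r : ℝ, 0 < r → (r ^ θ / r) ^ α = r ^ (-((1 - θ) * α)) := by
    intro r hr
    rw [show r ^ θ / r = r ^ (θ - 1) by rw [Real.rpow_sub hr, Real.rpow_one],
      ← Real.rpow_mul hr.le]
    congr 1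
    ring
  have hinv : ∀ r : ℝ, 0 < r → (r ^ θ) ^ (1 / θ) = r := by
    intro r hr
    rw [← Real.rpow_mul hr.le, mul_one_div_cancel h0.ne', Real.rpow_one]
  have hinv' : ∀ δ : ℝ, 0 < δ → (δ ^ (1 / θ)) ^ θ = δ := by
    intro r hr
    rw [← Real.rpow_mul hr.le, one_div_mul_cancel h0.ne', Real.rpow_one]
  constructor
  · rintro ⟨C, hC, h⟩
    refine ⟨C, hC, fun r hr hr1 x hx => ?_⟩
    have := h (r ^ θ) (Real.rpow_pos_of_pos hr _) (Real.rpow_le_one hr.le hr1 h0.le) x hx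
    rw [hinv r hr, key r hr, ballCoveringNumber_le_ofReal_iff (by positivity)] at this
    exact this
  · rintro ⟨C, hC, h⟩
    refine ⟨C, hC, fun δ hδ hδ1 x hx => ?_⟩
    have hr : 0 < δ ^ (1 / θ) := Real.rpow_pos_of_pos hδ _
    have := h (δ ^ (1 / θ)) hr (Real.rpow_le_one hδ.le hδ1 (by positivity)) x hx
    rw [← key _ hr, hinv' δ hδ] at this
    rw [ballCoveringNumber_le_ofReal_iff (by positivity)]
    exact this

theorem HasGrowth.mono {θ b b' : ℝ} {F : Set X} (h : HasGrowth θ F b) (hb : b ≤ b') :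
    HasGrowth θ F b' := by
  obtain ⟨C, hC, h⟩ := h
  refine ⟨C, hC, fun r hr hr1 x hx => (h r hr hr1 x hx).mono le_rfl subset_rfl ?_⟩
  exact mul_le_mul_of_nonneg_left
    (Real.rpow_le_rpow_of_exponent_ge hr hr1 (neg_le_neg hb)) hC.le

theorem le_of_hasGrowth {θ b φ : ℝ} {F : Set X} (h0 : 0 < θ) (h1 : θ < 1)
    (hF : assouadSpectrum θ F = (φ : EReal)) (h : HasGrowth θ F b) : (1 - θ) * φ ≤ b := by
  have h1' : 0 < 1 - θ := by linarith
  have hadm : IsAdmissibleExponent θ F (b / (1 - θ)) := by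
    rw [isAdmissibleExponent_iff_hasGrowth h0, mul_div_cancel₀ _ h1'.ne']
    exact h
  have : (φ : EReal) ≤ ((b / (1 - θ) : ℝ) : EReal) := by
    rw [← hF]
    exact iInf₂_le _ hadm
  rw [EReal.coe_le_coe_iff, le_div_iff₀ h1'] at this
  linarith

/-- The inequality is strict because the infimum defining the spectrum need not be attained. -/
theorem hasGrowth_of_lt {θ b φ : ℝ} {F : Set X} (h0 : 0 < θ) (h1 : θ < 1)
    (hF : assouadSpectrum θ F = (φ : EReal)) (h : (1 - θ) * φ < b) : HasGrowth θ F b := by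
  have h1' : 0 < 1 - θ := by linarith
  have hlt : assouadSpectrum θ F < ((b / (1 - θ) : ℝ) : EReal) := by
    rw [hF, EReal.coe_lt_coe_iff, lt_div_iff₀ h1']
    linarith
  simp only [assouadSpectrum, iInf_lt_iff] at hlt
  obtain ⟨α, hα, hlt⟩ := hlt
  rw [EReal.coe_lt_coe_iff, lt_div_iff₀ h1'] at hlt
  exact ((isAdmissibleExponent_iff_hasGrowth h0).1 hα).mono (by linarith)

theorem assouadSpectrum_eq_of_hasGrowth {θ φ : ℝ} {F : Set X} (h0 : 0 < θ) (h1 : θ < 1)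
    (h : HasGrowth θ F ((1 - θ) * φ)) (hle : ∀ b, HasGrowth θ F b → (1 - θ) * φ ≤ b) :
    assouadSpectrum θ F = (φ : EReal) := by
  apply le_antisymm
  · exact iInf₂_le _ ((isAdmissibleExponent_iff_hasGrowth h0).2 h)
  · refine le_iInf₂ fun α hα => ?_
    have := hle _ ((isAdmissibleExponent_iff_hasGrowth h0).1 hα)
    rw [EReal.coe_le_coe_iff]
    exact le_of_mul_le_mul_left this (by linarith)

theorem HasGrowth.of_le {lam θ b : ℝ} {F : Set X} (h : HasGrowth lam F b) (hle : lam ≤ θ) :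
    HasGrowth θ F b := by
  obtain ⟨C, hC, h⟩ := h
  refine ⟨C, hC, fun r hr hr1 x hx => (h r hr hr1 x hx).mono le_rfl ?_ le_rfl⟩
  exact Set.inter_subset_inter_right _
    (Metric.ball_subset_ball (Real.rpow_le_rpow_of_exponent_ge hr hr1 hle))

end Growth

/-! ### Necessity: covering in two steps -/

/-- In a finite-dimensional normed space, balls are covered by boundedly many balls of half the
radius. -/
theorem exists_card_cover_ball_half (E : Type*) [NormedAddCommGroup E] [NormedSpace ℝ E]
    [FiniteDimensional ℝ E] : ∃ K : ℕ, ∀ (z : E) (ρ : ℝ), 0 < ρ →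
      ∃ T : Finset E, T.card ≤ K ∧ ∀ y, dist y z < ρ → ∃ c ∈ T, dist y c < ρ / 2 := by
  classical
  have : ProperSpace E := FiniteDimensional.proper ℝ E
  obtain ⟨t, -, htf, ht⟩ := (isCompact_closedBall (0 : E) 1).finite_cover_balls
    (e := 1 / 2) (by norm_num)
  refine ⟨htf.toFinset.card, fun z ρ hρ =>
    ⟨htf.toFinset.image fun c => z + ρ • c, Finset.card_image_le, fun y hy => ?_⟩⟩
  have hmem : ρ⁻¹ • (y - z) ∈ Metric.closedBall (0 : E) 1 := by
    rw [mem_closedBall_zero_iff, norm_smul, norm_inv, Real.norm_of_nonneg hρ.le,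
      inv_mul_le_iff₀ hρ, mul_one, ← dist_eq_norm]
    exact hy.le
  obtain ⟨c, hc, hyc⟩ := Set.mem_iUnion₂.1 (ht hmem)
  refine ⟨z + ρ • c, Finset.mem_image_of_mem _ (by simpa using hc), ?_⟩
  have e : y - (z + ρ • c) = ρ • (ρ⁻¹ • (y - z) - c) := by
    rw [smul_sub, smul_inv_smul₀ hρ.ne']
    abel
  rw [Metric.mem_ball, dist_eq_norm] at hyc
  rw [dist_eq_norm, e, norm_smul, Real.norm_of_nonneg hρ.le]
  nlinarith

theorem HasGrowth.add {E : Type*} [NormedAddCommGroup E] [NormedSpace ℝ E]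
    [FiniteDimensional ℝ E] {lam θ b c : ℝ} {F : Set E} (hθ : 0 < θ)
    (h₁ : HasGrowth (lam / θ) F b) (h₂ : HasGrowth θ F c) : HasGrowth lam F (θ * b + c) := by
  obtain ⟨C₁, hC₁, h₁⟩ := h₁
  obtain ⟨C₂, hC₂, h₂⟩ := h₂
  obtain ⟨K, hK⟩ := exists_card_cover_ball_half E
  -- `K + 1` rather than `K` keeps the constant positive.
  refine ⟨C₁ * ((K + 1) * C₂), by positivity, fun r hr hr1 x hx => ?_⟩
  have hρ : 0 < r ^ θ := Real.rpow_pos_of_pos hr _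
  obtain ⟨S, hS, hSc⟩ := h₁ (r ^ θ) hρ (Real.rpow_le_one hr.le hr1 hθ.le) x hx
  rw [← Real.rpow_mul hr.le, mul_div_cancel₀ _ hθ.ne'] at hS
  have e : C₁ * ((K + 1) * C₂) * r ^ (-(θ * b + c)) =
      (C₁ * (r ^ θ) ^ (-b)) * ((K + 1) * (C₂ * r ^ (-c))) := by
    rw [← Real.rpow_mul hr.le, show -(θ * b + c) = θ * -b + -c by ring, Real.rpow_add hr]
    ring
  rw [e]
  refine FinCov.of_cover S (fun z => Metric.ball z (r ^ θ)) hS hSc (by positivity) fun z _ => ?_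
  -- The centre `z` need not lie in `F`. A ball of half the radius that meets `F` lies in a ball of
  -- radius `r ^ θ` centred in `F`, where `h₂` applies.
  obtain ⟨T, hTc, hT⟩ := hK z (r ^ θ) hρ
  refine FinCov.of_cover T (fun w => Metric.ball w (r ^ θ / 2)) (fun y hy => hT y hy.2) ?_
    (by positivity) fun w _ => ?_
  · have : (T.card : ℝ) ≤ K := by exact_mod_cast hTc
    linarith
  · by_cases hne : (F ∩ Metric.ball w (r ^ θ / 2)).Nonempty
    · obtain ⟨y, hyF, hyw⟩ := hne
      refine (h₂ r hr hr1 y hyF).mono le_rfl ?_ le_rfl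
      rintro y' ⟨⟨⟨hF', -⟩, -⟩, hyw'⟩
      refine ⟨hF', ?_⟩
      rw [Metric.mem_ball] at *
      have := dist_triangle_right y' y w
      linarith
    · refine (FinCov.empty (by positivity)).mono le_rfl ?_ le_rfl
      rintro y' ⟨⟨⟨hF', -⟩, -⟩, hyw'⟩
      exact hne ⟨y', hF', hyw'⟩

theorem spectrum_inequalities {E : Type*} [NormedAddCommGroup E] [NormedSpace ℝ E]
    [FiniteDimensional ℝ E] {φ : ℝ → ℝ} {F : Set E}
    (hF : ∀ θ ∈ Set.Ioo (0 : ℝ) 1, assouadSpectrum θ F = (φ θ : EReal))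
    {lam θ : ℝ} (h0 : 0 < lam) (hlt : lam < θ) (h1 : θ < 1) :
    0 ≤ (1 - lam) * φ lam - (1 - θ) * φ θ ∧
      (1 - lam) * φ lam - (1 - θ) * φ θ ≤ (θ - lam) * φ (lam / θ) := by
  have hθ : 0 < θ := h0.trans hlt
  have hq0 : 0 < lam / θ := div_pos h0 hθ
  have hq1 : lam / θ < 1 := (div_lt_one hθ).2 hlt
  have Hl := hF lam ⟨h0, hlt.trans h1⟩
  have Hθ := hF θ ⟨hθ, h1⟩
  have Hq := hF (lam / θ) ⟨hq0, hq1⟩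
  constructor
  · rw [sub_nonneg]
    refine le_of_forall_pos_le_add fun ε hε => ?_
    exact le_of_hasGrowth hθ h1 Hθ
      ((hasGrowth_of_lt h0 (hlt.trans h1) Hl (lt_add_of_pos_right _ hε)).of_le hlt.le)
  · rw [sub_le_iff_le_add]
    refine le_of_forall_pos_le_add fun ε hε => ?_
    -- This exponent is used at scale `r ^ θ`, so its error is multiplied by `θ`.
    have hb := hasGrowth_of_lt hq0 hq1 Hq (b := (1 - lam / θ) * φ (lam / θ) + ε / (2 * θ))
      (lt_add_of_pos_right _ (by positivity))
    have hc := hasGrowth_of_lt hθ h1 Hθ (b := (1 - θ) * φ θ + ε / 2)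
      (lt_add_of_pos_right _ (by positivity))
    refine (le_of_hasGrowth h0 (hlt.trans h1) Hl (hb.add hθ hc)).trans_eq ?_
    field_simp
    ring

end AssouadSpectra

/-! ### Sets with restricted binary digits -/

namespace AssouadSpectra

open scoped Pointwise

section DigitSets

variable {d : ℕ}

/-- The points whose coordinates of index less than `a` are `0` or `2⁻¹ ^ (j + 1)`, and whose other
coordinates vanish. -/
noncomputable def digitSet (d j a : ℕ) : Finset (EuclideanSpace ℝ (Fin d)) :=
  open Classical in
  (Finset.univ.filter fun i : Fin d => (i : ℕ) < a).powerset.image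
    fun T => WithLp.toLp 2 fun i => if i ∈ T then (2⁻¹ : ℝ) ^ (j + 1) else 0

/-- The points whose coordinates have binary digits only at the positions `l + 1, …, l + p`, where
at position `j + 1` only the first `a j` coordinates may have a nonzero digit. -/
noncomputable def digitSum (d : ℕ) (a : ℕ → ℕ) (l : ℕ) : ℕ → Finset (EuclideanSpace ℝ (Fin d))
  | 0 => {0}
  | p + 1 => open Classical in digitSum d a l p + digitSet d (l + p) (a (l + p))

theorem mem_digitSet_apply {j a : ℕ} {x : EuclideanSpace ℝ (Fin d)} (hx : x ∈ digitSet d j a)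
    (i : Fin d) : x i = 0 ∨ x i = (2⁻¹ : ℝ) ^ (j + 1) := by
  classical
  simp only [digitSet, Finset.mem_image] at hx
  obtain ⟨T, -, rfl⟩ := hx
  by_cases h : i ∈ T <;> simp [h]

theorem zero_mem_digitSet (j a : ℕ) : (0 : EuclideanSpace ℝ (Fin d)) ∈ digitSet d j a := by
  classical
  simp only [digitSet, Finset.mem_image]
  refine ⟨∅, by simp, ?_⟩
  ext i
  simp

theorem card_digitSet {j a : ℕ} (ha : a ≤ d) : (digitSet d j a).card = 2 ^ a := by
  classical
  rw [digitSet, Finset.card_image_of_injective, Finset.card_powerset, Fin.card_filter_val_lt,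
    min_eq_right ha]
  intro T T' h
  ext i
  have := congrArg (fun x : EuclideanSpace ℝ (Fin d) => x i) h
  simp only at this
  have hpos : (2⁻¹ : ℝ) ^ (j + 1) ≠ 0 := by positivity
  by_cases h1 : i ∈ T <;> by_cases h2 : i ∈ T'
  · simp [h1, h2]
  · rw [if_pos h1, if_neg h2] at this
    exact (hpos this).elim
  · rw [if_neg h1, if_pos h2] at this
    exact (hpos this.symm).elim
  · simp [h1, h2]

theorem mem_digitSum_succ {a : ℕ → ℕ} {l p : ℕ} {x : EuclideanSpace ℝ (Fin d)} :
    x ∈ digitSum d a l (p + 1) ↔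
      ∃ u ∈ digitSum d a l p, ∃ v ∈ digitSet d (l + p) (a (l + p)), u + v = x := by
  classical
  simp only [digitSum, Finset.mem_add]

theorem zero_mem_digitSum (a : ℕ → ℕ) (l p : ℕ) :
    (0 : EuclideanSpace ℝ (Fin d)) ∈ digitSum d a l p := by
  induction p with
  | zero => simp [digitSum]
  | succ p ih => exact mem_digitSum_succ.2 ⟨0, ih, 0, zero_mem_digitSet _ _, add_zero _⟩

theorem digitSum_mono (a : ℕ → ℕ) (l : ℕ) : Monotone (digitSum d a l) :=
  monotone_nat_of_le_succ fun _ x hx =>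
    mem_digitSum_succ.2 ⟨x, hx, 0, zero_mem_digitSet _ _, add_zero _⟩

theorem mem_digitSum_add {a : ℕ → ℕ} {l p q : ℕ} {x : EuclideanSpace ℝ (Fin d)} :
    x ∈ digitSum d a l (p + q) ↔
      ∃ u ∈ digitSum d a l p, ∃ v ∈ digitSum d a (l + p) q, u + v = x := by
  induction q generalizing x with
  | zero => simp [digitSum]
  | succ q ih =>
    rw [← add_assoc, mem_digitSum_succ]
    constructor
    · rintro ⟨y, hy, w, hw, rfl⟩
      obtain ⟨u, hu, v, hv, rfl⟩ := ih.1 hy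
      rw [← add_assoc] at hw
      exact ⟨u, hu, v + w, mem_digitSum_succ.2 ⟨v, hv, w, hw, rfl⟩, (add_assoc _ _ _).symm⟩
    · rintro ⟨u, hu, y, hy, rfl⟩
      obtain ⟨v, hv, w, hw, rfl⟩ := mem_digitSum_succ.1 hy
      rw [add_assoc l] at hw
      exact ⟨u + v, ih.2 ⟨u, hu, v, hv, rfl⟩, w, hw, add_assoc _ _ _⟩

theorem digitSum_apply_mem {a : ℕ → ℕ} {l p : ℕ} {x : EuclideanSpace ℝ (Fin d)}
    (hx : x ∈ digitSum d a l p) (i : Fin d) :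
    0 ≤ x i ∧ x i ≤ (2⁻¹ : ℝ) ^ l - (2⁻¹ : ℝ) ^ (l + p) := by
  induction p generalizing x with
  | zero =>
    simp only [digitSum, Finset.mem_singleton] at hx
    simp [hx]
  | succ p ih =>
    obtain ⟨u, hu, v, hv, rfl⟩ := mem_digitSum_succ.1 hx
    have hpos : (0 : ℝ) < (2⁻¹ : ℝ) ^ (l + p) := by positivity
    have hs : (2⁻¹ : ℝ) ^ (l + p + 1) = (2⁻¹ : ℝ) ^ (l + p) / 2 := by rw [pow_succ]; ring
    have h1 := ih hu
    rw [PiLp.add_apply, ← add_assoc, hs]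
    rcases mem_digitSet_apply hv i with h | h
    · rw [h]
      constructor <;> linarith
    · rw [h, hs]
      constructor <;> linarith

theorem digitSum_apply_le {a : ℕ → ℕ} {l p : ℕ} {x : EuclideanSpace ℝ (Fin d)}
    (hx : x ∈ digitSum d a l p) (i : Fin d) : |x i| ≤ (2⁻¹ : ℝ) ^ l := by
  have h := digitSum_apply_mem hx i
  have hpos : (0 : ℝ) < (2⁻¹ : ℝ) ^ (l + p) := by positivity
  rw [abs_of_nonneg h.1]
  linarith

theorem digitSum_apply_eq_intCast {a : ℕ → ℕ} {l p : ℕ} {x : EuclideanSpace ℝ (Fin d)}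
    (hx : x ∈ digitSum d a l p) (i : Fin d) : ∃ z : ℤ, x i = z * (2⁻¹ : ℝ) ^ (l + p) := by
  induction p generalizing x with
  | zero =>
    simp only [digitSum, Finset.mem_singleton] at hx
    exact ⟨0, by simp [hx]⟩
  | succ p ih =>
    obtain ⟨u, hu, v, hv, rfl⟩ := mem_digitSum_succ.1 hx
    obtain ⟨z, hz⟩ := ih hu
    rw [PiLp.add_apply, hz]
    rcases mem_digitSet_apply hv i with h | h
    · refine ⟨2 * z, ?_⟩
      rw [h, ← add_assoc, pow_succ]
      push_cast
      ring
    · refine ⟨2 * z + 1, ?_⟩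
      rw [h, ← add_assoc, pow_succ]
      push_cast
      ring

theorem card_digitSum {a : ℕ → ℕ} (ha : ∀ j, a j ≤ d) (l p : ℕ) :
    (digitSum d a l p).card = 2 ^ ∑ j ∈ Finset.range p, a (l + j) := by
  classical
  induction p with
  | zero => simp [digitSum]
  | succ p ih =>
    rw [Finset.sum_range_succ, pow_add, ← ih, ← card_digitSet (j := l + p) (ha (l + p)),
      digitSum, Finset.card_add_iff]
    rintro ⟨u, v⟩ ⟨hu, hv⟩ ⟨u', v'⟩ ⟨hu', hv'⟩ h
    simp only [Finset.mem_coe] at hu hv hu' hv' h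
    -- Parity: in units of `2⁻¹ ^ (l + p + 1)` the coordinates of `u` and `u'` are even, those of
    -- `v` and `v'` are `0` or `1`.
    have hvv : v = v' := by
      ext i
      obtain ⟨z, hz⟩ := digitSum_apply_eq_intCast hu i
      obtain ⟨z', hz'⟩ := digitSum_apply_eq_intCast hu' i
      have hi := congrArg (fun x : EuclideanSpace ℝ (Fin d) => x i) h
      simp only [PiLp.add_apply] at hi
      have hpos : (2⁻¹ : ℝ) ^ (l + p) ≠ 0 := by positivity
      rw [hz, hz'] at hi
      rcases mem_digitSet_apply hv i with h1 | h1 <;>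
        rcases mem_digitSet_apply hv' i with h2 | h2
      · rw [h1, h2]
      · rw [h1, h2, pow_succ] at hi
        have h3 : (2 * z : ℝ) = 2 * z' + 1 := by
          apply mul_right_cancel₀ hpos
          linarith
        have h4 : 2 * z = 2 * z' + 1 := by exact_mod_cast h3
        omega
      · rw [h1, h2, pow_succ] at hi
        have h3 : (2 * z + 1 : ℝ) = 2 * z' := by
          apply mul_right_cancel₀ hpos
          linarith
        have h4 : 2 * z + 1 = 2 * z' := by exact_mod_cast h3
        omega
      · rw [h1, h2]
    subst hvv
    simpa using h

/-- The crude factor `2 ^ d` amounts to a shift by `d` dyadic levels. -/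
theorem norm_lt_two_pow_mul {ρ : ℝ} (hρ : 0 < ρ) {x : EuclideanSpace ℝ (Fin d)}
    (hx : ∀ i, |x i| ≤ ρ) : ‖x‖ < 2 ^ d * ρ := by
  have hd : (d : ℝ) < 2 ^ d := by exact_mod_cast Nat.lt_two_pow_self
  have h1 : ‖x‖ ≤ d * ρ := by
    rw [EuclideanSpace.norm_eq]
    apply Real.sqrt_le_iff.2
    refine ⟨by positivity, ?_⟩
    calc ∑ i, ‖x i‖ ^ 2 ≤ ∑ _i : Fin d, ρ ^ 2 := by
          refine Finset.sum_le_sum fun i _ => ?_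
          have := hx i
          rw [Real.norm_eq_abs]
          gcongr
      _ = d * ρ ^ 2 := by simp
      _ ≤ (d * ρ) ^ 2 := by
          rw [mul_pow]
          gcongr
          exact_mod_cast Nat.le_self_pow (by norm_num) d
  nlinarith

theorem card_grid_le {ε : ℝ} (hε : 0 < ε) (T : Finset (EuclideanSpace ℝ (Fin d)))
    (hT : ∀ u ∈ T, ∀ i, ∃ z : ℤ, u i = z * ε) (x : EuclideanSpace ℝ (Fin d)) (k : ℕ)
    (hx : ∀ u ∈ T, dist u x < k * ε) : T.card ≤ (2 * k + 1) ^ d := by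
  classical
  have hcard : (Fintype.piFinset fun _ : Fin d => Finset.Icc (-(k : ℤ)) k).card =
      (2 * k + 1) ^ d := by
    rw [Fintype.card_piFinset]
    simp only [Int.card_Icc, Finset.prod_const, Finset.card_univ, Fintype.card_fin]
    congr 1
    omega
  rw [← hcard]
  refine Finset.card_le_card_of_injOn (fun u i => ⌊u i / ε⌋ - ⌊x i / ε⌋) ?_ ?_
  · intro u hu
    simp only [Finset.mem_coe, Fintype.mem_piFinset, Finset.mem_Icc]
    intro i
    obtain ⟨z, hz⟩ := hT u hu i
    have h1 : |u i - x i| < k * ε := by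
      refine lt_of_le_of_lt ?_ (hx u hu)
      rw [dist_eq_norm, ← Real.norm_eq_abs]
      exact PiLp.norm_apply_le (u - x) i
    rw [hz, mul_div_cancel_right₀ _ hε.ne', Int.floor_intCast]
    rw [hz] at h1
    have h2 : |(z : ℝ) - x i / ε| < k := by
      have : (z : ℝ) - x i / ε = (z * ε - x i) / ε := by field_simp
      rw [this, abs_div, abs_of_pos hε, div_lt_iff₀ hε]
      exact h1
    rw [abs_lt] at h2
    have h3 := Int.floor_le (x i / ε)
    have h4 := Int.lt_floor_add_one (x i / ε)
    have h5 : (-(k : ℤ) : ℝ) - 1 < ((z - ⌊x i / ε⌋ : ℤ) : ℝ) := by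
      push_cast
      linarith
    have h6 : ((z - ⌊x i / ε⌋ : ℤ) : ℝ) < ((k : ℤ) : ℝ) + 1 := by
      push_cast
      linarith
    have h5' : -(k : ℤ) - 1 < z - ⌊x i / ε⌋ := by exact_mod_cast h5
    have h6' : z - ⌊x i / ε⌋ < (k : ℤ) + 1 := by exact_mod_cast h6
    omega
  · intro u hu v hv h
    ext i
    have hi := congrFun h i
    simp only [sub_left_inj] at hi
    obtain ⟨z, hz⟩ := hT u hu i
    obtain ⟨w, hw⟩ := hT v hv i
    rw [hz, hw, mul_div_cancel_right₀ _ hε.ne', mul_div_cancel_right₀ _ hε.ne',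
      Int.floor_intCast, Int.floor_intCast] at hi
    rw [hz, hw, hi]

/-- The set of points all of whose binary digits obey the restrictions given by `a`. -/
def digitUnion (d : ℕ) (a : ℕ → ℕ) : Set (EuclideanSpace ℝ (Fin d)) :=
  {x | ∃ p, x ∈ digitSum d a 0 p}

theorem digitUnion_apply_mem {a : ℕ → ℕ} {x : EuclideanSpace ℝ (Fin d)} (hx : x ∈ digitUnion d a)
    (i : Fin d) : 0 ≤ x i ∧ x i < 1 := by
  obtain ⟨p, hp⟩ := hx
  have h := digitSum_apply_mem hp i
  have hpos : (0 : ℝ) < (2⁻¹ : ℝ) ^ (0 + p) := by positivity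
  rw [pow_zero] at h
  exact ⟨h.1, by linarith⟩

/-- Split a point into its first `l` digits, the next `q` and a tail. The first block is a grid
point near `x`, with boundedly many choices; the second gives the count; the tail is absorbed in the
radius. -/
theorem finCov_digitUnion {a : ℕ → ℕ} (ha : ∀ j, a j ≤ d) (l q : ℕ)
    (x : EuclideanSpace ℝ (Fin d)) :
    FinCov (2 ^ d * (2⁻¹ : ℝ) ^ (l + q)) (digitUnion d a ∩ Metric.ball x ((2⁻¹ : ℝ) ^ l))
      ((2 * (2 ^ d + 1) + 1) ^ d * 2 ^ ∑ j ∈ Finset.range q, a (l + j)) := by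
  classical
  set T := (digitSum d a 0 l).filter fun u => dist u x < ((2 ^ d + 1 : ℕ) : ℝ) * (2⁻¹ : ℝ) ^ l
    with hT
  have hTc : T.card ≤ (2 * (2 ^ d + 1) + 1) ^ d := by
    refine card_grid_le (ε := (2⁻¹ : ℝ) ^ l) (by positivity) T (fun u hu i => ?_) x _ fun u hu => ?_
    · have := digitSum_apply_eq_intCast (Finset.mem_filter.1 hu).1 i
      rwa [zero_add] at this
    · exact (Finset.mem_filter.1 hu).2
  refine ⟨T + digitSum d a l q, ?_, ?_⟩
  · rintro y ⟨⟨p, hp⟩, hyx⟩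
    -- Zero digits pad the expansion to length at least `l + q`.
    have hp' : y ∈ digitSum d a 0 (l + (q + p)) := digitSum_mono a 0 (by omega) hp
    obtain ⟨u, hu, t, ht, rfl⟩ := mem_digitSum_add.1 hp'
    rw [zero_add] at ht
    have htn : ‖t‖ < 2 ^ d * (2⁻¹ : ℝ) ^ l :=
      norm_lt_two_pow_mul (by positivity) (digitSum_apply_le ht)
    obtain ⟨w, hw, v, hv, rfl⟩ := mem_digitSum_add.1 ht
    refine ⟨u + w, Finset.add_mem_add (Finset.mem_filter.2 ⟨hu, ?_⟩) hw, ?_⟩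
    · rw [Metric.mem_ball] at hyx
      have h1 := dist_triangle_left u x (u + (w + v))
      have h2 : dist (u + (w + v)) u = ‖w + v‖ := by simp
      push_cast
      linarith
    · rw [← add_assoc]
      simpa using norm_lt_two_pow_mul (by positivity) (digitSum_apply_le hv)
  · have hc : ((digitSum d a l q).card : ℝ) = 2 ^ ∑ j ∈ Finset.range q, a (l + j) := by
      exact_mod_cast card_digitSum ha l q
    rw [← hc]
    calc ((T + digitSum d a l q).card : ℝ) ≤ T.card * (digitSum d a l q).card := by
          exact_mod_cast Finset.card_add_le
      _ ≤ _ := by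
          gcongr
          exact_mod_cast hTc

/-- The points lie on a grid of mesh equal to the radius, so each ball contains at most `3 ^ d` of
them. -/
theorem two_pow_le_of_finCov {a : ℕ → ℕ} (ha : ∀ j, a j ≤ d) (l p : ℕ) {B : ℝ}
    {E : Set (EuclideanSpace ℝ (Fin d))} (hE : ∀ x ∈ digitSum d a l p, x ∈ E)
    (h : FinCov ((2⁻¹ : ℝ) ^ (l + p)) E B) :
    (2 : ℝ) ^ (∑ j ∈ Finset.range p, a (l + j)) ≤ 3 ^ d * B := by
  classical
  obtain ⟨S, hS, hSc⟩ := h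
  have h1 : (digitSum d a l p).card ≤ 3 ^ d * S.card := by
    refine (Finset.card_le_card (t := S.biUnion fun c =>
      (digitSum d a l p).filter fun x => dist x c < (2⁻¹ : ℝ) ^ (l + p)) fun x hx => ?_).trans
      ?_
    · obtain ⟨c, hc, hxc⟩ := hS x (hE x hx)
      exact Finset.mem_biUnion.2 ⟨c, hc, Finset.mem_filter.2 ⟨hx, hxc⟩⟩
    · rw [mul_comm]
      refine Finset.card_biUnion_le_card_mul _ _ _ fun c _ => ?_
      refine card_grid_le (ε := (2⁻¹ : ℝ) ^ (l + p)) (by positivity) _ (fun u hu i => ?_) c 1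
        fun u hu => ?_
      · exact digitSum_apply_eq_intCast (Finset.mem_filter.1 hu).1 i
      · simpa using (Finset.mem_filter.1 hu).2
  rw [card_digitSum ha] at h1
  have h2 : (2 : ℝ) ^ (∑ j ∈ Finset.range p, a (l + j)) ≤ 3 ^ d * S.card := by exact_mod_cast h1
  exact h2.trans (by gcongr)

end DigitSets

end AssouadSpectra

/-! ### The branching function -/

namespace AssouadSpectra

/-- The function `(1 - t) φ(t)`, extended by `0` to `t ≥ 1`. -/
noncomputable def weight (φ : ℝ → ℝ) (t : ℝ) : ℝ := if t < 1 then (1 - t) * φ t else 0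

/-- The branching function at stage `n`: its increment from `θ n` to `n` is `n (1 - θ) φ(θ)`, and
its increment from `θ t` to `t` is at most `t (1 - θ) φ(θ)`. -/
noncomputable def profile (φ : ℝ → ℝ) (n t : ℝ) : ℝ := -(n * weight φ (max t 1 / n))

/-- The integer increments of the branching function. -/
noncomputable def branching (φ : ℝ → ℝ) (n : ℝ) (j : ℕ) : ℕ :=
  (⌊profile φ n (j + 1)⌋ - ⌊profile φ n j⌋).toNat

/-- The two-sided inequality that characterises Assouad spectra, together with the trivial bounds
`0 ≤ φ ≤ d`. -/
structure IsSpectrumProfile (d : ℕ) (φ : ℝ → ℝ) : Prop where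
  mem_Icc : ∀ θ ∈ Set.Ioo (0 : ℝ) 1, φ θ ∈ Set.Icc (0 : ℝ) d
  le : ∀ lam θ : ℝ, 0 < lam → lam < θ → θ < 1 → (1 - θ) * φ θ ≤ (1 - lam) * φ lam
  sub_le : ∀ lam θ : ℝ, 0 < lam → lam < θ → θ < 1 →
    (1 - lam) * φ lam - (1 - θ) * φ θ ≤ (θ - lam) * φ (lam / θ)

namespace IsSpectrumProfile

variable {d : ℕ} {φ : ℝ → ℝ}

theorem weight_nonneg (h : IsSpectrumProfile d φ) {t : ℝ} (ht : 0 < t) : 0 ≤ weight φ t := by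
  unfold weight
  split_ifs with h1
  · exact mul_nonneg (by linarith) (h.mem_Icc t ⟨ht, h1⟩).1
  · exact le_rfl

theorem weight_le (h : IsSpectrumProfile d φ) {t : ℝ} (ht : 0 < t) (ht1 : t ≤ 1) :
    weight φ t ≤ d * (1 - t) := by
  unfold weight
  split_ifs with h1
  · rw [mul_comm]
    exact mul_le_mul_of_nonneg_right (h.mem_Icc t ⟨ht, h1⟩).2 (by linarith)
  · exact mul_nonneg (by positivity) (by linarith)

theorem weight_anti (h : IsSpectrumProfile d φ) {s t : ℝ} (hs : 0 < s) (hst : s ≤ t) :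
    weight φ t ≤ weight φ s := by
  rcases hst.eq_or_lt with rfl | hlt
  · exact le_rfl
  · by_cases h1 : t < 1
    · simpa only [weight, if_pos h1, if_pos (hlt.trans h1)] using h.le s t hs hlt h1
    · rw [weight, if_neg h1]
      exact h.weight_nonneg hs

theorem weight_sub_le (h : IsSpectrumProfile d φ) {s t : ℝ} (hs : 0 < s) (hst : s ≤ t) :
    weight φ s - weight φ t ≤ t * weight φ (s / t) := by
  have ht : 0 < t := hs.trans_le hst
  have hq : 0 < s / t := div_pos hs ht
  rcases hst.eq_or_lt with rfl | hlt
  · rw [sub_self]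
    exact mul_nonneg ht.le (h.weight_nonneg hq)
  · by_cases h1 : t < 1
    · have hq1 : s / t < 1 := (div_lt_one ht).2 hlt
      simp only [weight, if_pos h1, if_pos (hlt.trans h1), if_pos hq1]
      refine (h.sub_le s t hs hlt h1).trans_eq ?_
      field_simp
    · push Not at h1
      have h2 : weight φ t = 0 := if_neg h1.not_gt
      have h3 : weight φ s ≤ weight φ (s / t) := h.weight_anti hq (div_le_self hs.le h1)
      have h4 := h.weight_nonneg hq
      nlinarith

variable {n : ℝ}

/-- The truncation `max t 1` keeps the argument of `weight` positive, where the hypotheses on `φ`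
apply. -/
theorem profile_mono (h : IsSpectrumProfile d φ) (hn : 0 < n) : Monotone (profile φ n) := by
  intro s t hst
  unfold profile
  have : weight φ (max t 1 / n) ≤ weight φ (max s 1 / n) := by
    apply h.weight_anti
    · positivity
    · gcongr
  nlinarith

/-- This is `weight_sub_le` rescaled; the bound no longer depends on `n`. -/
theorem profile_sub_le_mul_weight (h : IsSpectrumProfile d φ) (hn : 0 < n) {s t : ℝ}
    (hst : s ≤ t) :
    profile φ n t - profile φ n s ≤ max t 1 * weight φ (max s 1 / max t 1) := by
  have hs : (0 : ℝ) < max s 1 := by positivity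
  have ht : (0 : ℝ) < max t 1 := by positivity
  have h1 := h.weight_sub_le (s := max s 1 / n) (t := max t 1 / n) (by positivity) (by gcongr)
  rw [div_div_div_cancel_right₀ hn.ne'] at h1
  unfold profile
  calc -(n * weight φ (max t 1 / n)) - -(n * weight φ (max s 1 / n))
      = n * (weight φ (max s 1 / n) - weight φ (max t 1 / n)) := by ring
    _ ≤ n * (max t 1 / n * weight φ (max s 1 / max t 1)) := by gcongr
    _ = _ := by field_simp

theorem profile_sub_le (h : IsSpectrumProfile d φ) (hn : 0 < n) {s t : ℝ} (hst : s ≤ t) :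
    profile φ n t - profile φ n s ≤ d * (t - s) := by
  have ht : (0 : ℝ) < max t 1 := by positivity
  have hle : max s 1 ≤ max t 1 := by gcongr
  have h1 : weight φ (max s 1 / max t 1) ≤ d * (1 - max s 1 / max t 1) :=
    h.weight_le (by positivity) ((div_le_one ht).2 hle)
  have h2 : max t 1 - max s 1 ≤ t - s := by
    rcases le_total t 1 with h3 | h3
    · rw [max_eq_right h3, max_eq_right (hst.trans h3)]
      linarith
    · rw [max_eq_left h3]
      linarith [le_max_left s 1]
  calc profile φ n t - profile φ n s ≤ max t 1 * weight φ (max s 1 / max t 1) :=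
        h.profile_sub_le_mul_weight hn hst
    _ ≤ max t 1 * (d * (1 - max s 1 / max t 1)) := by gcongr
    _ = d * (max t 1 - max s 1) := by field_simp
    _ ≤ d * (t - s) := by gcongr

theorem profile_window_le (h : IsSpectrumProfile d φ) (hn : 0 < n) {θ t : ℝ} (h0 : 0 < θ)
    (h1 : θ < 1) (ht : 0 ≤ t) :
    profile φ n t - profile φ n (θ * t) ≤ t * ((1 - θ) * φ θ) := by
  have hst : θ * t ≤ t := mul_le_of_le_one_left ht h1.le
  have hw : weight φ θ = (1 - θ) * φ θ := if_pos h1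
  rw [← hw]
  have hw0 := h.weight_nonneg h0
  rcases le_total t 1 with h2 | h2
  · have : profile φ n t = profile φ n (θ * t) := by
      rw [profile, profile, max_eq_right h2, max_eq_right (hst.trans h2)]
    rw [this, sub_self]
    positivity
  · have h3 := h.profile_sub_le_mul_weight hn hst
    rw [max_eq_left h2] at h3
    refine h3.trans (mul_le_mul_of_nonneg_left (h.weight_anti h0 ?_) ht)
    rw [le_div_iff₀ (by linarith)]
    exact le_max_left _ _

theorem profile_window_eq (hn : 1 ≤ n) {θ : ℝ} (h1 : θ < 1) (hθn : 1 ≤ θ * n) :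
    profile φ n n - profile φ n (θ * n) = n * ((1 - θ) * φ θ) := by
  have hn0 : n ≠ 0 := by positivity
  rw [profile, profile, max_eq_left hn, max_eq_left hθn, div_self hn0, mul_div_cancel_right₀ _ hn0,
    weight, if_neg (lt_irrefl _), weight, if_pos h1]
  ring

theorem branching_le (h : IsSpectrumProfile d φ) (hn : 0 < n) (j : ℕ) : branching φ n j ≤ d := by
  rw [branching, Int.toNat_le, sub_le_iff_le_add, ← Int.lt_add_one_iff, Int.floor_lt]
  have h1 := h.profile_sub_le hn (show (j : ℝ) ≤ j + 1 by linarith)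
  have h2 := Int.lt_floor_add_one (profile φ n j)
  push_cast
  linarith

/-- The sum telescopes, so rounding costs at most `1` over any number of levels. -/
theorem sum_branching (h : IsSpectrumProfile d φ) (hn : 0 < n) (l q : ℕ) :
    ((∑ j ∈ Finset.range q, branching φ n (l + j) : ℕ) : ℤ) =
      ⌊profile φ n ((l + q : ℕ) : ℝ)⌋ - ⌊profile φ n l⌋ := by
  induction q with
  | zero => simp
  | succ q ih =>
    rw [Finset.sum_range_succ, Nat.cast_add, ih, branching, Int.toNat_of_nonneg]
    · rw [← add_assoc, Nat.cast_add_one (l + q)]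
      ring
    · exact sub_nonneg.2 (Int.floor_le_floor (h.profile_mono hn (by linarith)))

theorem sum_branching_le (h : IsSpectrumProfile d φ) (hn : 0 < n) (l q : ℕ) :
    ((∑ j ∈ Finset.range q, branching φ n (l + j) : ℕ) : ℝ) ≤
      profile φ n ((l + q : ℕ) : ℝ) - profile φ n l + 1 := by
  have e : ((∑ j ∈ Finset.range q, branching φ n (l + j) : ℕ) : ℝ) =
      (⌊profile φ n ((l + q : ℕ) : ℝ)⌋ : ℝ) - ⌊profile φ n l⌋ := by
    exact_mod_cast h.sum_branching hn l q
  rw [e]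
  linarith [Int.floor_le (profile φ n ((l + q : ℕ) : ℝ)), Int.lt_floor_add_one (profile φ n l)]

theorem le_sum_branching (h : IsSpectrumProfile d φ) (hn : 0 < n) (l q : ℕ) :
    profile φ n ((l + q : ℕ) : ℝ) - profile φ n l - 1 ≤
      ((∑ j ∈ Finset.range q, branching φ n (l + j) : ℕ) : ℝ) := by
  have e : ((∑ j ∈ Finset.range q, branching φ n (l + j) : ℕ) : ℝ) =
      (⌊profile φ n ((l + q : ℕ) : ℝ)⌋ : ℝ) - ⌊profile φ n l⌋ := by
    exact_mod_cast h.sum_branching hn l q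
  rw [e]
  linarith [Int.lt_floor_add_one (profile φ n ((l + q : ℕ) : ℝ)), Int.floor_le (profile φ n l)]

end IsSpectrumProfile

/-! ### The set realising the spectrum -/

/-- The point all of whose coordinates are `3 n`. -/
noncomputable def diagShift (d n : ℕ) : EuclideanSpace ℝ (Fin d) := WithLp.toLp 2 fun _ => 3 * n

/-- The union over `n ≥ 1` of the digit sets with branching function `profile φ n`, translated so
that they are separated. -/
def spectrumSet (d : ℕ) (φ : ℝ → ℝ) : Set (EuclideanSpace ℝ (Fin d)) :=
  {x | ∃ n : ℕ, 0 < n ∧ x - diagShift d n ∈ digitUnion d (branching φ n)}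

theorem exists_spectrumSet_inter_ball_subset {d : ℕ} {φ : ℝ → ℝ} {x : EuclideanSpace ℝ (Fin d)}
    (hx : x ∈ spectrumSet d φ) : ∃ n : ℕ, 0 < n ∧ ∀ y ∈ spectrumSet d φ, dist y x < 1 →
      y - diagShift d n ∈ digitUnion d (branching φ n) := by
  obtain ⟨n, hn, hxn⟩ := hx
  refine ⟨n, hn, ?_⟩
  rintro y ⟨k, hk, hyk⟩ hyx
  -- For `d = 0` the translates coincide, but the space is a single point.
  rcases Nat.eq_zero_or_pos d with rfl | hd
  · rwa [Subsingleton.elim y x]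
  · suffices hkn : k = n by rwa [← hkn]
    have h1 := digitUnion_apply_mem hxn ⟨0, hd⟩
    have h2 := digitUnion_apply_mem hyk ⟨0, hd⟩
    have h3 : |y ⟨0, hd⟩ - x ⟨0, hd⟩| < 1 := by
      refine lt_of_le_of_lt ?_ hyx
      rw [dist_eq_norm, ← Real.norm_eq_abs]
      exact PiLp.norm_apply_le (y - x) _
    simp only [diagShift, PiLp.sub_apply] at h1 h2
    rw [abs_lt] at h3
    have h4 : (k : ℝ) < n + 1 := by linarith
    have h5 : (n : ℝ) < k + 1 := by linarith
    have h4' : k < n + 1 := by exact_mod_cast h4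
    have h5' : n < k + 1 := by exact_mod_cast h5
    omega

theorem FinCov.of_sub {V : Type*} [NormedAddCommGroup V] {r B : ℝ} {E E' : Set V} (v : V)
    (h : FinCov r E B) (hE : ∀ y ∈ E', y - v ∈ E) : FinCov r E' B := by
  classical
  obtain ⟨S, hS, hc⟩ := h
  refine ⟨S.image (· + v), fun y hy => ?_, le_trans ?_ hc⟩
  · obtain ⟨c, hc, hyc⟩ := hS _ (hE y hy)
    refine ⟨c + v, Finset.mem_image_of_mem _ hc, ?_⟩
    rwa [← dist_sub_right y (c + v) v, add_sub_cancel_right]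
  · exact_mod_cast Finset.card_image_le

theorem inv_two_pow_eq_rpow (k : ℕ) : (2⁻¹ : ℝ) ^ k = (2 : ℝ) ^ (-(k : ℝ)) := by
  rw [Real.rpow_neg (by norm_num), Real.rpow_natCast, inv_pow]

theorem IsSpectrumProfile.hasGrowth_spectrumSet {d : ℕ} {φ : ℝ → ℝ} (h : IsSpectrumProfile d φ)
    {θ : ℝ} (h0 : 0 < θ) (h1 : θ < 1) : HasGrowth θ (spectrumSet d φ) ((1 - θ) * φ θ) := by
  set K : ℝ := (2 * (2 ^ d + 1) + 1) ^ d with hK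
  have hKpos : 0 < K := by positivity
  -- The exponent collects `d * (1 + d)` from raising `t` to `l + q`, `d` from lowering `θ * t` to
  -- `l`, and `1` from rounding.
  refine ⟨K * 2 ^ ((d : ℝ) * (1 + d) + d + 1), by positivity, fun r hr hr1 x hx => ?_⟩
  obtain ⟨n, hn, hsub⟩ := exists_spectrumSet_inter_ball_subset hx
  have hn' : (0 : ℝ) < n := by exact_mod_cast hn
  obtain ⟨t, ht, rfl⟩ : ∃ t : ℝ, 0 ≤ t ∧ r = 2 ^ (-t) := by
    refine ⟨-Real.logb 2 r, ?_, ?_⟩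
    · have := Real.logb_nonpos (b := 2) (by norm_num) hr.le hr1
      linarith
    · rw [neg_neg, Real.rpow_logb (by norm_num) (by norm_num) hr]
  have hθt : θ * t ≤ t := mul_le_of_le_one_left ht h1.le
  have hθt0 : 0 ≤ θ * t := by positivity
  set l := ⌊θ * t⌋₊ with hl
  have hl1 : (l : ℝ) ≤ θ * t := Nat.floor_le hθt0
  have hl2 : θ * t < l + 1 := Nat.lt_floor_add_one _
  set m := ⌈t⌉₊ with hm
  have hm1 : t ≤ m := Nat.le_ceil t
  have hm2 : (m : ℝ) < t + 1 := Nat.ceil_lt_add_one ht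
  have hlm : l ≤ m := by
    have : (l : ℝ) ≤ m := by linarith
    exact_mod_cast this
  -- The `d` extra levels cancel the factor `2 ^ d` in the covering radius.
  obtain ⟨q, hq⟩ : ∃ q, l + q = m + d := ⟨m + d - l, by omega⟩
  have hcov := finCov_digitUnion (h.branching_le hn') l q (x - diagShift d n)
  refine (hcov.of_sub (diagShift d n) (E' := spectrumSet d φ ∩
    Metric.ball x ((2 ^ (-t)) ^ θ)) ?_).mono ?_ subset_rfl ?_
  · rintro y ⟨hy, hyx⟩
    rw [Metric.mem_ball] at hyx
    have hball : ((2 : ℝ) ^ (-t)) ^ θ ≤ (2⁻¹ : ℝ) ^ l := by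
      rw [inv_two_pow_eq_rpow, ← Real.rpow_mul (by norm_num)]
      exact Real.rpow_le_rpow_of_exponent_le (by norm_num) (by linarith)
    refine ⟨hsub y hy (hyx.trans_le (hball.trans (pow_le_one₀ (by norm_num) (by norm_num)))), ?_⟩
    rw [Metric.mem_ball, dist_sub_right]
    exact hyx.trans_le hball
  · rw [hq, inv_two_pow_eq_rpow, ← Real.rpow_natCast, ← Real.rpow_add (by norm_num)]
    apply Real.rpow_le_rpow_of_exponent_le (by norm_num)
    push_cast
    linarith
  · rw [mul_assoc K, ← Real.rpow_mul (by norm_num), ← Real.rpow_add (by norm_num),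
      ← Real.rpow_natCast 2 (∑ j ∈ _, _)]
    gcongr
    · norm_num
    · have e1 := h.sum_branching_le hn' l q
      have e2 := h.profile_window_le hn' h0 h1 ht
      have e3 := h.profile_sub_le hn' (show t ≤ ((l + q : ℕ) : ℝ) by rw [hq]; push_cast; linarith)
      have e4 := h.profile_sub_le hn' hl1
      have e5 : (d : ℝ) * (((l + q : ℕ) : ℝ) - t) ≤ d * (1 + d) := by
        gcongr
        rw [hq]
        push_cast
        linarith
      have e6 : (d : ℝ) * (θ * t - l) ≤ d := mul_le_of_le_one_right (by positivity) (by linarith)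
      linarith

theorem IsSpectrumProfile.le_of_hasGrowth_spectrumSet {d : ℕ} {φ : ℝ → ℝ}
    (h : IsSpectrumProfile d φ) {θ : ℝ} (h0 : 0 < θ) (h1 : θ < 1) {b : ℝ}
    (hb : HasGrowth θ (spectrumSet d φ) b) : (1 - θ) * φ θ ≤ b := by
  obtain ⟨C, hC, hb⟩ := hb
  by_contra! hlt
  set M : ℝ := 3 ^ d * C * 2 ^ ((d : ℝ) * (1 + d) + 1) with hM
  have hMpos : 0 < M := by positivity
  -- the lower bound on covering numbers at scale `2 ^ (-n)`
  have key : ∀ n : ℕ, 1 ≤ θ * n → d + 1 ≤ (1 - θ) * n →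
      (2 : ℝ) ^ ((n : ℝ) * ((1 - θ) * φ θ - b)) ≤ M := by
    intro n hθn hdn
    have hn1 : (1 : ℝ) ≤ n := by nlinarith [n.cast_nonneg (α := ℝ)]
    have hn' : (0 : ℝ) < n := by linarith
    have hn : 0 < n := by exact_mod_cast hn'
    have hm1 : θ * n ≤ ⌈θ * n⌉₊ := Nat.le_ceil _
    have hm2 : (⌈θ * n⌉₊ : ℝ) < θ * n + 1 := Nat.ceil_lt_add_one (by positivity)
    -- Again `d` extra levels: points with digits only beyond `l` have norm below `2 ^ d * 2⁻¹ ^ l ≤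
    -- (2⁻¹ ^ n) ^ θ`, so their translates stay in the ball about the corner `diagShift d n`.
    set l := ⌈θ * n⌉₊ + d with hl
    have hl1 : θ * n + d ≤ l := by rw [hl]; push_cast; linarith
    have hl2 : (l : ℝ) < θ * n + 1 + d := by rw [hl]; push_cast; linarith
    have hln : l ≤ n := by
      have : (l : ℝ) < n := by linarith
      exact_mod_cast this.le
    obtain ⟨p, hp⟩ : ∃ p, l + p = n := ⟨n - l, by omega⟩
    have hmem : diagShift d n ∈ spectrumSet d φ :=
      ⟨n, hn, 0, by rw [sub_self]; exact zero_mem_digitSum _ _ _⟩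
    have hcov := hb ((2⁻¹ : ℝ) ^ n) (by positivity) (pow_le_one₀ (by norm_num) (by norm_num)) _ hmem
    have hcov' := hcov.of_sub (-diagShift d n)
      (E' := {y | y + diagShift d n ∈ spectrumSet d φ ∩
        Metric.ball (diagShift d n) (((2⁻¹ : ℝ) ^ n) ^ θ)}) (fun y hy => by
          rw [sub_neg_eq_add]; exact hy)
    have hbound := two_pow_le_of_finCov (h.branching_le hn') l p (B := C * ((2⁻¹ : ℝ) ^ n) ^ (-b))
      (E := {y | y + diagShift d n ∈ spectrumSet d φ ∩
        Metric.ball (diagShift d n) (((2⁻¹ : ℝ) ^ n) ^ θ)}) (fun y hy => by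
          refine ⟨⟨n, hn, l + p, ?_⟩, ?_⟩
          · rw [add_sub_cancel_right]
            exact mem_digitSum_add.2 ⟨0, zero_mem_digitSum _ _ _, y, by rwa [zero_add],
              zero_add _⟩
          · rw [Metric.mem_ball, dist_eq_norm, add_sub_cancel_right]
            refine (norm_lt_two_pow_mul (by positivity) (digitSum_apply_le hy)).trans_le ?_
            rw [inv_two_pow_eq_rpow, inv_two_pow_eq_rpow, ← Real.rpow_natCast 2 d,
              ← Real.rpow_add (by norm_num), ← Real.rpow_mul (by norm_num)]
            apply Real.rpow_le_rpow_of_exponent_le (by norm_num)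
            linarith) (by rw [hp]; exact hcov')
    rw [inv_two_pow_eq_rpow, ← Real.rpow_mul (by norm_num), ← Real.rpow_natCast 2 (∑ j ∈ _, _)]
      at hbound
    have e1 := h.le_sum_branching hn' l p
    rw [hp] at e1
    have e2 := IsSpectrumProfile.profile_window_eq (φ := φ) hn1 h1 hθn
    have e3 := h.profile_sub_le hn' (show θ * n ≤ l by linarith [d.cast_nonneg (α := ℝ)])
    have e4 : (d : ℝ) * (l - θ * n) ≤ d * (1 + d) := by
      gcongr
      linarith
    calc (2 : ℝ) ^ ((n : ℝ) * ((1 - θ) * φ θ - b))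
        ≤ 2 ^ (((∑ j ∈ Finset.range p, branching φ n (l + j) : ℕ) : ℝ) +
            (((d : ℝ) * (1 + d) + 1) + -(n * b))) := by
          apply Real.rpow_le_rpow_of_exponent_le (by norm_num)
          linarith
      _ = 2 ^ ((∑ j ∈ Finset.range p, branching φ n (l + j) : ℕ) : ℝ) *
            (2 ^ ((d : ℝ) * (1 + d) + 1) * 2 ^ (-(n * b))) := by
          rw [Real.rpow_add (by norm_num), Real.rpow_add (by norm_num)]
      _ ≤ (3 ^ d * (C * 2 ^ (-(n : ℝ) * -b))) *
            (2 ^ ((d : ℝ) * (1 + d) + 1) * 2 ^ (-(n * b))) := by gcongr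
      _ = M * (2 ^ (-(n : ℝ) * -b) * 2 ^ (-(n * b))) := by rw [hM]; ring
      _ = M := by
          rw [← Real.rpow_add (by norm_num), show -(n : ℝ) * -b + -(n * b) = 0 by ring,
            Real.rpow_zero, mul_one]
  have hgap : 0 < (1 - θ) * φ θ - b := by linarith
  have htend : Filter.Tendsto (fun n : ℕ => (2 : ℝ) ^ ((n : ℝ) * ((1 - θ) * φ θ - b)))
      Filter.atTop Filter.atTop := by
    refine (tendsto_rpow_atTop_of_base_gt_one 2 (by norm_num)).comp ?_
    exact tendsto_natCast_atTop_atTop.atTop_mul_const hgap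
  have hA : Filter.Tendsto (fun n : ℕ => θ * (n : ℝ)) Filter.atTop Filter.atTop :=
    tendsto_natCast_atTop_atTop.const_mul_atTop h0
  have hB : Filter.Tendsto (fun n : ℕ => (1 - θ) * (n : ℝ)) Filter.atTop Filter.atTop :=
    tendsto_natCast_atTop_atTop.const_mul_atTop (by linarith)
  obtain ⟨n, hn1, hn2, hn3⟩ := ((htend.eventually_gt_atTop M).and
    ((hA.eventually_ge_atTop 1).and (hB.eventually_ge_atTop (d + 1)))).exists
  exact (key n hn2 hn3).not_gt hn1

end AssouadSpectra

theorem theoremA (d : ℕ) (φ : ℝ → ℝ)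
    (hφ : ∀ θ ∈ Set.Ioo (0 : ℝ) 1, φ θ ∈ Set.Icc (0 : ℝ) d) :
    (∃ F : Set (EuclideanSpace ℝ (Fin d)), ∀ θ ∈ Set.Ioo (0 : ℝ) 1,
        AssouadSpectra.assouadSpectrum θ F = (φ θ : EReal)) ↔
      ∀ lam θ : ℝ, 0 < lam → lam < θ → θ < 1 →
        0 ≤ (1 - lam) * φ lam - (1 - θ) * φ θ ∧
          (1 - lam) * φ lam - (1 - θ) * φ θ ≤ (θ - lam) * φ (lam / θ) := by
  constructor
  · rintro ⟨F, hF⟩ lam θ h0 hlt h1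
    exact AssouadSpectra.spectrum_inequalities hF h0 hlt h1
  · intro h
    have hp : AssouadSpectra.IsSpectrumProfile d φ :=
      ⟨hφ, fun lam θ h0 hlt h1 => sub_nonneg.1 (h lam θ h0 hlt h1).1,
        fun lam θ h0 hlt h1 => (h lam θ h0 hlt h1).2⟩
    exact ⟨AssouadSpectra.spectrumSet d φ, fun θ hθ =>
      AssouadSpectra.assouadSpectrum_eq_of_hasGrowth hθ.1 hθ.2
        (hp.hasGrowth_spectrumSet hθ.1 hθ.2)
        fun _ hb => hp.le_of_hasGrowth_spectrumSet hθ.1 hθ.2 hb⟩
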